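/- Let $N\in\mathbb N$, $K\ge 0$, natural frequencies $\Omega=(\Omega_1,\dots,\Omega_N)\in\mathbb R^N$ and an initial configuration $\Theta_0\in\mathbb R^N$. For $\theta\in\mathbb R$ let $\bar\theta\in(-\pi,\pi]$ be its representative modulo $2\pi$ and $|\theta|_o:=|\bar\theta|$. Put $$h(\theta)=\frac{\sin\theta}{|\theta|_o}\ (\theta\notin 2\pi\mathbb Z),\quad h(\theta)=0\ (\theta\in2\pi\mathbb Z),\qquad h_\varepsilon(\theta)=\frac{\sin\theta}{(\varepsilon^2+|\theta|_o^2)^{1/2}}\quad(\varepsilon>0)$$ (the critical exponent $\alpha=\tfrac12$), and $$H_i(\Theta)=\Omega_i+\frac KN\sum_{j=1}^N h(\theta_j-\theta_i),\qquad H_i^\varepsilon(\Theta)=\Omega_i+\frac KN\sum_{j=1}^N h_\varepsilon(\theta_j-\theta_i).$$ Let $\mathcal H$ be the Filippov set-valued map of $H$, i.e. $\mathcal H(\Theta)=\bigcap_{\delta>0}\bigcap_{|\mathcal N|=0}\overline{\mathrm{co}}\,\big(H(B_\delta(\Theta)\setminus\mathcal N)\big)$, where $\mathcal N$ runs over the Lebesgue-null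 sets. For every $\varepsilon>0$ let $\Theta^\varepsilon=(\theta^\varepsilon_1,\dots,\theta^\varepsilon_N):[0,\infty)\to\mathbb R^N$ be the classical solution of $\dot\Theta^\varepsilon=H^\varepsilon(\Theta^\varepsilon)$, $\Theta^\varepsilon(0)=\Theta_0$. Then: 1. With $C_\Omega:=\big(\sum_{i=1}^N\Omega_i^2\big)^{1/2}$, one has $|\dot\theta_i^\varepsilon(t)|\le C_\Omega+K$ for all $\varepsilon>0$, $t\ge0$ and $i=1,\dots,N$. In particular $\{\Theta^\varepsilon\}_{\varepsilon>0}$ is bounded in $W^{1,\infty}((0,T);\mathbb R^N)$ for every $T>0$. 2. Let $\varepsilon_n>0$, $\varepsilon_n\to0$, and suppose that $\Theta^{\varepsilon_n}$ converges to $\Theta$ weakly-* in $W^{1,\infty}_{loc}$; that is, for every $T>0$, $\Theta\in W^{1,\infty}((0,T);\mathbb R^N)$, $\Theta^{\varepsilon_n}\overset{*}{\rightharpoonup}\Theta$ and $\dot\Theta^{\varepsilon_n}\overset{*}{\rightharpoonup}\dot\Theta$ in $L^\infty((0,T);\mathbb R^N)$, where $\dot\Theta$ is the weak derivative. Then $$\dot\Theta(t)\in\mathcal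 H(\Theta(t))\quad\text{for a.e. }t\ge0,$$ and $\Theta$ (after modification on a null set) is a Filippov solution of $\dot\Theta=H(\Theta)$ with initial datum $\Theta_0$: it is absolutely continuous on every $[0,T]$, $\Theta(0)=\Theta_0$, and its a.e. derivative belongs to $\mathcal H(\Theta(t))$ for a.e. $t\ge0$. -/

import Mathlib

open MeasureTheory Set Filter Topology
open scoped ENNReal ContDiff

noncomputable section

namespace SingularKuramoto

/-- Representative of `θ` modulo `2π` in `(-π, π]`. -/
def bar (θ : ℝ) : ℝ := toIocMod Real.two_pi_pos (-Real.pi) θ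

/-- Orthodromic distance (to zero) on the unit circle, `|θ|_o = |bar θ|`. -/
def orthodromic (θ : ℝ) : ℝ := |bar θ|

/-- Singular kernel `h(θ) = sin θ / |θ|_o ^ (2α)`; at `θ ∈ 2πℤ` its value is `0`
(for `α > 0`). -/
def kernel (α θ : ℝ) : ℝ := Real.sin θ / orthodromic θ ^ (2 * α)

/-- Regularized kernel `h_ε(θ) = sin θ / (ε² + |θ|_o²) ^ α`. -/
def regKernel (α ε θ : ℝ) : ℝ := Real.sin θ / (ε ^ 2 + orthodromic θ ^ 2) ^ α

/-- The Kuramoto vector field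
`H_i(Θ) = Ω_i + (K / N) ∑_j k(θ_j - θ_i)` with interaction kernel `k`. -/
def field {N : ℕ} (Ω : EuclideanSpace ℝ (Fin N)) (K : ℝ) (k : ℝ → ℝ)
    (Θ : EuclideanSpace ℝ (Fin N)) : EuclideanSpace ℝ (Fin N) :=
  WithLp.toLp 2 fun i => Ω i + K / N * ∑ j, k (Θ j - Θ i)

/-- The singular field `H`. -/
def singField {N : ℕ} (Ω : EuclideanSpace ℝ (Fin N)) (K α : ℝ) :
    EuclideanSpace ℝ (Fin N) → EuclideanSpace ℝ (Fin N) :=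
  field Ω K (kernel α)

/-- The regularized field `H^ε`. -/
def regField {N : ℕ} (Ω : EuclideanSpace ℝ (Fin N)) (K α ε : ℝ) :
    EuclideanSpace ℝ (Fin N) → EuclideanSpace ℝ (Fin N) :=
  field Ω K (regKernel α ε)

/-- Global-in-time classical solution on `[0, ∞)` of `x' = F(x)`, `x(0) = x₀`
(the derivative at `0` is one-sided). -/
structure IsClassicalSolution {N : ℕ}
    (F : EuclideanSpace ℝ (Fin N) → EuclideanSpace ℝ (Fin N))
    (x₀ : EuclideanSpace ℝ (Fin N)) (x : ℝ → EuclideanSpace ℝ (Fin N)) : Prop where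
  initial : x 0 = x₀
  hasDeriv : ∀ t, 0 ≤ t → HasDerivWithinAt x (F (x t)) (Ici 0) t

/-- The Filippov set-valued map of `F`:
`⋂_{δ > 0} ⋂_{|𝒩| = 0} closure (co (F (B_δ(x) \ 𝒩)))`. -/
def filippov {N : ℕ} (F : EuclideanSpace ℝ (Fin N) → EuclideanSpace ℝ (Fin N))
    (x : EuclideanSpace ℝ (Fin N)) : Set (EuclideanSpace ℝ (Fin N)) :=
  ⋂ (δ : ℝ) (_ : 0 < δ) (𝒩 : Set (EuclideanSpace ℝ (Fin N))) (_ : volume 𝒩 = 0),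
    closure (convexHull ℝ (F '' (Metric.ball x δ \ 𝒩)))

/-- Global-in-time solution in Filippov's sense of `x' = F(x)`, `x(0) = x₀`: an absolutely
continuous curve whose derivative lies in the Filippov map of `F` for almost every `t ≥ 0`. -/
structure IsFilippovSolution {N : ℕ}
    (F : EuclideanSpace ℝ (Fin N) → EuclideanSpace ℝ (Fin N))
    (x₀ : EuclideanSpace ℝ (Fin N)) (x : ℝ → EuclideanSpace ℝ (Fin N)) : Prop where
  initial : x 0 = x₀
  absCont : ∀ T, 0 < T → AbsolutelyContinuousOnInterval x 0 T
  inclusion : ∀ᵐ t ∂(volume.restrict (Ici (0 : ℝ))), ∃ v ∈ filippov F (x t), HasDerivAt x v t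

/-- `u ∈ W^{1,∞}((0, T); ℝᴺ)` for every `T > 0`, with weak derivative `v`. -/
structure MemW1InfLoc {N : ℕ} (u v : ℝ → EuclideanSpace ℝ (Fin N)) : Prop where
  memLp : ∀ T, 0 < T → MemLp u ∞ (volume.restrict (Ioo 0 T))
  memLp_deriv : ∀ T, 0 < T → MemLp v ∞ (volume.restrict (Ioo 0 T))
  weakDeriv : ∀ φ : ℝ → ℝ, ContDiff ℝ ∞ φ → HasCompactSupport φ → tsupport φ ⊆ Ioi 0 →
    ∫ t in Ioi (0 : ℝ), deriv φ t • u t = - ∫ t in Ioi (0 : ℝ), φ t • v t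

/-- Weak-* convergence in `L^∞((0, T); ℝᴺ)` (as the dual of `L¹((0, T); ℝᴺ)`)
for every `T > 0`. -/
def TendstoWeakStarLinf {N : ℕ} (u : ℕ → ℝ → EuclideanSpace ℝ (Fin N))
    (u' : ℝ → EuclideanSpace ℝ (Fin N)) : Prop :=
  ∀ T, 0 < T → ∀ g : ℝ → EuclideanSpace ℝ (Fin N),
    Integrable g (volume.restrict (Ioo 0 T)) →
      Tendsto (fun n => ∫ t in Ioo 0 T, inner ℝ (g t) (u n t)) atTop
        (𝓝 (∫ t in Ioo 0 T, inner ℝ (g t) (u' t)))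

/-- The functions `u n`, with derivatives `v n`, converge weakly-* in
`W^{1,∞}((0, T); ℝᴺ)` for every `T > 0` to `u'`, with weak derivative `v'`. -/
structure TendstoWeakStarW1InfLoc {N : ℕ} (u v : ℕ → ℝ → EuclideanSpace ℝ (Fin N))
    (u' v' : ℝ → EuclideanSpace ℝ (Fin N)) : Prop where
  memLimit : MemW1InfLoc u' v'
  tendsto : TendstoWeakStarLinf u u'
  tendsto_deriv : TendstoWeakStarLinf v v'

end SingularKuramoto

end

open SingularKuramoto

namespace SingularKuramoto

/-! At the critical exponent `|sin θ| ≤ |θ|_o` bounds both kernels by 1, uniformly in ε, which gives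
the velocity bounds at once. The limit inclusion is proved by duality, with no explicit description
of the Filippov set.

Fix a direction `w`. Since the kernels are odd, `inner_field` turns `⟪w, H x⟫` into a sum of terms
`(w i - w j) * h (x j - x i)`. Replacing each term at a collision (difference in 2πℤ) by `|w i - w
j|` gives `fieldEnvelope`. It bounds the regularized fields asymptotically from above as ε → 0 and
the base point tends to `x` (`eventually_inner_regField_lt`). It is also sharp for `H`: it is the
limit of `⟪w, H (x - s • w)⟫` as s ↓ 0, and this pairing is continuous at those points for small
`s`, so values close to the envelope fill open sets that no null set removes. By Hahn–Banach,
domination by the envelope in every direction implies membership in the Filippov set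
(`mem_filippov_of_inner_le`).

Weak-* convergence of the velocities makes the trajectories converge pointwise to the primitive of
`v`. The upper bound then passes to `v` for each fixed `w` (`ae_inner_le`), and a countable dense
set of directions gives one null set for all `w`. -/

theorem orthodromic_eq_arccos_cos (θ : ℝ) : orthodromic θ = Real.arccos (Real.cos θ) := by
  have h1 : |bar θ| ≤ Real.pi := Real.Angle.abs_toReal_le_pi (θ : Real.Angle)
  have h2 : Real.cos (bar θ) = Real.cos θ := by
    have := Real.Angle.cos_toReal (θ : Real.Angle)
    rwa [Real.Angle.cos_coe] at this
  rw [← h2, ← Real.cos_abs, Real.arccos_cos (abs_nonneg _) h1, orthodromic]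

/-- The representative `bar` jumps at odd multiples of π, but its absolute value does not; the
formula through `arccos ∘ cos` makes this visible. -/
theorem continuous_orthodromic : Continuous orthodromic := by
  have : orthodromic = fun θ => Real.arccos (Real.cos θ) := funext orthodromic_eq_arccos_cos
  rw [this]
  exact Real.continuous_arccos.comp Real.continuous_cos

theorem orthodromic_nonneg (θ : ℝ) : 0 ≤ orthodromic θ := abs_nonneg _

theorem orthodromic_neg (θ : ℝ) : orthodromic (-θ) = orthodromic θ := by
  simp [orthodromic_eq_arccos_cos]

theorem orthodromic_eq_zero_iff (θ : ℝ) : orthodromic θ = 0 ↔ Real.cos θ = 1 := by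
  rw [orthodromic_eq_arccos_cos, Real.arccos_eq_zero]
  exact ⟨fun h => le_antisymm (Real.cos_le_one θ) h, fun h => h.ge⟩

theorem abs_sin_le_orthodromic (θ : ℝ) : |Real.sin θ| ≤ orthodromic θ := by
  have h : Real.sin (bar θ) = Real.sin θ := by
    have := Real.Angle.sin_toReal (θ : Real.Angle)
    rwa [Real.Angle.sin_coe] at this
  rw [← h]
  exact Real.abs_sin_le_abs

theorem kernel_half (θ : ℝ) : kernel (1 / 2) θ = Real.sin θ / orthodromic θ := by
  norm_num [kernel]

theorem regKernel_half (ε θ : ℝ) :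
    regKernel (1 / 2) ε θ = Real.sin θ / Real.sqrt (ε ^ 2 + orthodromic θ ^ 2) := by
  rw [regKernel, Real.sqrt_eq_rpow]

theorem kernel_neg (α θ : ℝ) : kernel α (-θ) = -kernel α θ := by
  simp [kernel, orthodromic_neg, neg_div]

theorem regKernel_neg (α ε θ : ℝ) : regKernel α ε (-θ) = -regKernel α ε θ := by
  simp [regKernel, orthodromic_neg, neg_div]

theorem abs_kernel_half_le_one (θ : ℝ) : |kernel (1 / 2) θ| ≤ 1 := by
  rw [kernel_half, abs_div, abs_of_nonneg (orthodromic_nonneg θ)]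
  exact div_le_one_of_le₀ (abs_sin_le_orthodromic θ) (orthodromic_nonneg θ)

theorem abs_regKernel_half_le_one (ε θ : ℝ) : |regKernel (1 / 2) ε θ| ≤ 1 := by
  rw [regKernel_half, abs_div, abs_of_nonneg (Real.sqrt_nonneg _)]
  refine div_le_one_of_le₀ ((abs_sin_le_orthodromic θ).trans ?_) (Real.sqrt_nonneg _)
  exact Real.le_sqrt_of_sq_le (by nlinarith [sq_nonneg ε])

theorem continuousAt_kernel_half {θ : ℝ} (h : Real.cos θ ≠ 1) :
    ContinuousAt (kernel (1 / 2)) θ := by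
  have : kernel (1 / 2) = fun θ => Real.sin θ / orthodromic θ := funext kernel_half
  rw [this]
  exact Real.continuous_sin.continuousAt.div continuous_orthodromic.continuousAt
    (mt (orthodromic_eq_zero_iff θ).1 h)

theorem measurable_kernel_half : Measurable (kernel (1 / 2)) := by
  have : kernel (1 / 2) = fun θ => Real.sin θ / orthodromic θ := funext kernel_half
  rw [this]
  exact Real.measurable_sin.div continuous_orthodromic.measurable

theorem continuous_regKernel_half {ε : ℝ} (hε : 0 < ε) : Continuous (regKernel (1 / 2) ε) := by
  have : regKernel (1 / 2) ε =
    fun θ => Real.sin θ / Real.sqrt (ε ^ 2 + orthodromic θ ^ 2) := funext (regKernel_half ε)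
  rw [this]
  refine Real.continuous_sin.div
    ((continuous_const.add (continuous_orthodromic.pow 2)).sqrt) fun θ => ?_
  positivity

theorem tendsto_regKernel_half {ι : Type*} {l : Filter ι} {e y : ι → ℝ} {θ : ℝ}
    (he : Tendsto e l (𝓝 0)) (hy : Tendsto y l (𝓝 θ)) (h : Real.cos θ ≠ 1) :
    Tendsto (fun n => regKernel (1 / 2) (e n) (y n)) l (𝓝 (kernel (1 / 2) θ)) := by
  simp only [regKernel_half, kernel_half]
  have h0 : orthodromic θ ≠ 0 := mt (orthodromic_eq_zero_iff θ).1 h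
  have h1 : Tendsto (fun n => orthodromic (y n)) l (𝓝 (orthodromic θ)) :=
    continuous_orthodromic.continuousAt.tendsto.comp hy
  have h2 : Tendsto (fun n => Real.sqrt (e n ^ 2 + orthodromic (y n) ^ 2)) l
      (𝓝 (Real.sqrt (0 ^ 2 + orthodromic θ ^ 2))) := ((he.pow 2).add (h1.pow 2)).sqrt
  rw [zero_pow two_ne_zero, zero_add, Real.sqrt_sq (orthodromic_nonneg θ)] at h2
  exact (Real.continuous_sin.continuousAt.tendsto.comp hy).div h2 h0

/-! ### Upper envelope of the kernel -/

/-- The upper envelope of `a * h` at `φ`, where `h` is the critical kernel: the essential upper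
limit of `a * h` at `φ`. -/
noncomputable def kernelEnvelope (a φ : ℝ) : ℝ := if Real.cos φ = 1 then |a| else a * kernel (1 / 2) φ

theorem abs_kernelEnvelope_le (a φ : ℝ) : |kernelEnvelope a φ| ≤ |a| := by
  unfold kernelEnvelope
  split_ifs
  · rw [abs_abs]
  · rw [abs_mul]
    exact mul_le_of_le_one_right (abs_nonneg a) (abs_kernel_half_le_one φ)

theorem measurable_kernelEnvelope (a : ℝ) : Measurable (kernelEnvelope a) :=
  Measurable.ite (Real.measurable_cos (measurableSet_singleton 1)) measurable_const
    (measurable_kernel_half.const_mul a)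

theorem continuous_kernelEnvelope_left (φ : ℝ) : Continuous fun a => kernelEnvelope a φ := by
  unfold kernelEnvelope
  split_ifs
  · exact continuous_abs
  · exact continuous_id.mul continuous_const

/-- At a collision the regularized values need not converge, since they depend on the ratio of `y n
- φ` to `e n`; the uniform bound 1 suffices there. Elsewhere they converge to the singular kernel.
-/
theorem eventually_mul_regKernel_lt {ι : Type*} {l : Filter ι} {e y : ι → ℝ} {φ : ℝ} (a : ℝ)
    (he : Tendsto e l (𝓝 0)) (hy : Tendsto y l (𝓝 φ)) {η : ℝ} (hη : 0 < η) :
    ∀ᶠ n in l, a * regKernel (1 / 2) (e n) (y n) < kernelEnvelope a φ + η := by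
  unfold kernelEnvelope
  split_ifs with h
  · refine Eventually.of_forall fun n => ?_
    calc a * regKernel (1 / 2) (e n) (y n) ≤ |a * regKernel (1 / 2) (e n) (y n)| := le_abs_self _
      _ ≤ |a| := by
        rw [abs_mul]
        exact mul_le_of_le_one_right (abs_nonneg a) (abs_regKernel_half_le_one _ _)
      _ < |a| + η := lt_add_of_pos_right _ hη
  · exact ((tendsto_regKernel_half he hy h).const_mul a).eventually_lt_const
      (lt_add_of_pos_right _ hη)

theorem mul_kernel_half_of_abs_lt_pi {a s : ℝ} (hs : 0 < s) (h : |s * a| < Real.pi) :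
    a * kernel (1 / 2) (s * a) = |a| * Real.sinc (s * a) := by
  rcases eq_or_ne a 0 with rfl | ha
  · simp
  have hsa : s * a ≠ 0 := mul_ne_zero hs.ne' ha
  have ho : orthodromic (s * a) = s * |a| := by
    rw [orthodromic_eq_arccos_cos, ← Real.cos_abs, Real.arccos_cos (abs_nonneg _) h.le, abs_mul,
      abs_of_pos hs]
  rw [kernel_half, ho, Real.sinc_of_ne_zero hsa]
  have : |a| ≠ 0 := abs_ne_zero.2 ha
  field_simp
  rw [sq_abs, mul_comm]

theorem kernel_half_add_of_cos_eq_one {φ : ℝ} (h : Real.cos φ = 1) (s : ℝ) :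
    kernel (1 / 2) (φ + s) = kernel (1 / 2) s := by
  obtain ⟨k, rfl⟩ := (Real.cos_eq_one_iff φ).1 h
  rw [add_comm]
  simp only [kernel_half, orthodromic_eq_arccos_cos, Real.sin_add_int_mul_two_pi,
    Real.cos_add_int_mul_two_pi]

/-- Approaching a collision from the side given by the sign of `a` selects the one-sided limit of
`h` with that same sign, so the product tends to `|a|`. -/
theorem tendsto_mul_kernel_half (a φ : ℝ) :
    Tendsto (fun s => a * kernel (1 / 2) (φ + s * a)) (𝓝[>] 0) (𝓝 (kernelEnvelope a φ)) := by
  have h0 : Tendsto (fun s : ℝ => s * a) (𝓝[>] 0) (𝓝 0) := by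
    have : Tendsto (fun s : ℝ => s * a) (𝓝 0) (𝓝 (0 * a)) :=
      (continuous_id.mul continuous_const).tendsto 0
    rw [zero_mul] at this
    exact this.mono_left nhdsWithin_le_nhds
  unfold kernelEnvelope
  split_ifs with h
  · simp only [kernel_half_add_of_cos_eq_one h]
    have h1 : Tendsto (fun s : ℝ => |a| * Real.sinc (s * a)) (𝓝[>] 0) (𝓝 |a|) := by
      have := ((Real.continuous_sinc.tendsto 0).comp h0).const_mul |a|
      rwa [Real.sinc_zero, mul_one] at this
    refine h1.congr' ?_
    filter_upwards [self_mem_nhdsWithin,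
      h0.abs.eventually_lt_const (u := Real.pi) (by simpa using Real.pi_pos)] with s hs hlt
    exact (mul_kernel_half_of_abs_lt_pi hs hlt).symm
  · have h1 : Tendsto (fun s : ℝ => φ + s * a) (𝓝[>] 0) (𝓝 φ) := by
      simpa using h0.const_add φ
    exact ((continuousAt_kernel_half h).tendsto.comp h1).const_mul a

theorem eventually_continuousAt_mul_kernel_half (a φ : ℝ) :
    ∀ᶠ s in 𝓝[>] (0 : ℝ), ContinuousAt (fun θ => a * kernel (1 / 2) θ) (φ + s * a) := by
  rcases eq_or_ne a 0 with rfl | ha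
  · simp [continuousAt_const]
  have h0 : Tendsto (fun s : ℝ => s * a) (𝓝[>] 0) (𝓝 0) := by
    have : Tendsto (fun s : ℝ => s * a) (𝓝 0) (𝓝 (0 * a)) :=
      (continuous_id.mul continuous_const).tendsto 0
    rw [zero_mul] at this
    exact this.mono_left nhdsWithin_le_nhds
  have key : ∀ᶠ s in 𝓝[>] (0 : ℝ), Real.cos (φ + s * a) ≠ 1 := by
    by_cases h : Real.cos φ = 1
    · obtain ⟨k, rfl⟩ := (Real.cos_eq_one_iff φ).1 h
      filter_upwards [self_mem_nhdsWithin,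
        h0.abs.eventually_lt_const (u := Real.pi) (by simpa using Real.pi_pos)] with s hs hlt
      rw [add_comm, Real.cos_add_int_mul_two_pi]
      have := abs_lt.1 hlt
      rw [Ne, Real.cos_eq_one_iff_of_lt_of_lt (by linarith [Real.pi_pos])
        (by linarith [Real.pi_pos])]
      exact mul_ne_zero (ne_of_gt hs) ha
    · have h1 : Tendsto (fun s : ℝ => φ + s * a) (𝓝[>] 0) (𝓝 φ) := by
        simpa using h0.const_add φ
      exact ((Real.continuous_cos.tendsto φ).comp h1).eventually_ne h
  filter_upwards [key] with s hs
  exact continuousAt_const.mul (continuousAt_kernel_half hs)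

/-! ### The field tested in a direction, and duality with the Filippov set -/

variable {N : ℕ}

theorem inner_eq_sum (w z : EuclideanSpace ℝ (Fin N)) : inner ℝ w z = ∑ i, w i * z i := by
  simp [PiLp.inner_apply, mul_comm]

/-- For an odd interaction kernel, the field tested against `w` only sees differences of `w`. -/
theorem inner_field (Ω w x : EuclideanSpace ℝ (Fin N)) (K : ℝ) {k : ℝ → ℝ}
    (hk : ∀ θ, k (-θ) = -k θ) :
    inner ℝ w (field Ω K k x) =
      inner ℝ w Ω + K / N / 2 * ∑ i, ∑ j, (w i - w j) * k (x j - x i) := by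
  have hsymm : ∑ i, ∑ j, w j * k (x j - x i) = -∑ i, ∑ j, w i * k (x j - x i) := by
    rw [Finset.sum_comm, ← Finset.sum_neg_distrib]
    refine Finset.sum_congr rfl fun i _ => ?_
    rw [← Finset.sum_neg_distrib]
    refine Finset.sum_congr rfl fun j _ => ?_
    rw [← neg_sub (x j) (x i), hk, mul_neg]
  have hdiff : ∑ i, ∑ j, (w i - w j) * k (x j - x i) =
      2 * ∑ i, ∑ j, w i * k (x j - x i) := by
    simp only [sub_mul, Finset.sum_sub_distrib, hsymm]
    ring
  rw [hdiff, inner_eq_sum, inner_eq_sum]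
  simp only [field, mul_add, Finset.sum_add_distrib]
  congr 1
  rw [show K / N / 2 * (2 * ∑ i, ∑ j, w i * k (x j - x i)) =
    K / N * ∑ i, ∑ j, w i * k (x j - x i) by ring, Finset.mul_sum]
  refine Finset.sum_congr rfl fun i _ => ?_
  rw [← Finset.mul_sum]
  ring

/-- The upper envelope of `x ↦ ⟪w, H x⟫`, where `H` is the critical singular field; as a function
of `w` it is the support function of the Filippov set of `H` at `x`. -/
noncomputable def fieldEnvelope (Ω : EuclideanSpace ℝ (Fin N)) (K : ℝ)
    (w x : EuclideanSpace ℝ (Fin N)) : ℝ :=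
  inner ℝ w Ω + K / N / 2 * ∑ i, ∑ j, kernelEnvelope (w i - w j) (x j - x i)

theorem continuous_fieldEnvelope_left (Ω : EuclideanSpace ℝ (Fin N)) (K : ℝ)
    (x : EuclideanSpace ℝ (Fin N)) : Continuous fun w => fieldEnvelope Ω K w x := by
  unfold fieldEnvelope
  refine (continuous_id.inner continuous_const).add (continuous_const.mul ?_)
  refine continuous_finsetSum _ fun i _ => continuous_finsetSum _ fun j _ => ?_
  exact (continuous_kernelEnvelope_left (x j - x i)).comp (by fun_prop)

theorem measurable_fieldEnvelope (Ω : EuclideanSpace ℝ (Fin N)) (K : ℝ)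
    (w : EuclideanSpace ℝ (Fin N)) : Measurable fun x => fieldEnvelope Ω K w x := by
  unfold fieldEnvelope
  refine measurable_const.add (measurable_const.mul ?_)
  refine Finset.measurable_fun_sum _ fun i _ => Finset.measurable_fun_sum _ fun j _ => ?_
  exact (measurable_kernelEnvelope _).comp (by fun_prop)

theorem exists_abs_fieldEnvelope_le (Ω : EuclideanSpace ℝ (Fin N)) (K : ℝ)
    (w : EuclideanSpace ℝ (Fin N)) : ∃ C, ∀ x, |fieldEnvelope Ω K w x| ≤ C := by
  refine ⟨|inner ℝ w Ω| + |K / N / 2| * ∑ i, ∑ j, |w i - w j|, fun x => ?_⟩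
  refine (abs_add_le _ _).trans (add_le_add_right ?_ _)
  rw [abs_mul]
  refine mul_le_mul_of_nonneg_left ?_ (abs_nonneg _)
  refine (Finset.abs_sum_le_sum_abs _ _).trans (Finset.sum_le_sum fun i _ => ?_)
  refine (Finset.abs_sum_le_sum_abs _ _).trans (Finset.sum_le_sum fun j _ => ?_)
  exact abs_kernelEnvelope_le _ _

theorem eventually_inner_regField_lt {ι : Type*} {l : Filter ι} {K : ℝ} (hK : 0 ≤ K)
    (Ω w : EuclideanSpace ℝ (Fin N)) {e : ι → ℝ} {y : ι → EuclideanSpace ℝ (Fin N)}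
    {x : EuclideanSpace ℝ (Fin N)} (he : Tendsto e l (𝓝 0)) (hy : Tendsto y l (𝓝 x))
    {η : ℝ} (hη : 0 < η) :
    ∀ᶠ n in l, inner ℝ w (regField Ω K (1 / 2) (e n) (y n)) < fieldEnvelope Ω K w x + η := by
  set c : ℝ := K / N / 2 with hc
  have hc0 : 0 ≤ c := by positivity
  -- The total error of the N² pairs, weighted by `c`, stays below `η`; the `+ 1` keeps the
  -- denominator positive when `c` or `N` vanishes.
  set δ : ℝ := η / (c * (N * N) + 1) with hδ
  have hδ0 : 0 < δ := by positivity
  have hcoord (i : Fin N) : Tendsto (fun n => y n i) l (𝓝 (x i)) :=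
    ((EuclideanSpace.proj (𝕜 := ℝ) i).continuous.tendsto x).comp hy
  have hev : ∀ᶠ n in l, ∀ i j : Fin N,
      (w i - w j) * regKernel (1 / 2) (e n) (y n j - y n i) <
        kernelEnvelope (w i - w j) (x j - x i) + δ :=
    eventually_all.2 fun i => eventually_all.2 fun j =>
      eventually_mul_regKernel_lt _ he ((hcoord j).sub (hcoord i)) hδ0
  filter_upwards [hev] with n hn
  rw [regField, inner_field Ω w (y n) K (regKernel_neg _ _), fieldEnvelope, ← hc, add_assoc,
    add_lt_add_iff_left]
  have hsum : ∑ i, ∑ j, (w i - w j) * regKernel (1 / 2) (e n) (y n j - y n i) ≤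
      (∑ i, ∑ j, kernelEnvelope (w i - w j) (x j - x i)) + N * N * δ := by
    calc _ ≤ ∑ i : Fin N, ∑ j : Fin N, (kernelEnvelope (w i - w j) (x j - x i) + δ) :=
          Finset.sum_le_sum fun i _ => Finset.sum_le_sum fun j _ => (hn i j).le
      _ = _ := by
        simp [Finset.sum_add_distrib, mul_assoc]
  calc _ ≤ c * ((∑ i, ∑ j, kernelEnvelope (w i - w j) (x j - x i)) + N * N * δ) :=
        mul_le_mul_of_nonneg_left hsum hc0
    _ = c * (∑ i, ∑ j, kernelEnvelope (w i - w j) (x j - x i)) + c * (N * N) * δ := by ring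
    _ < _ := by
      rw [add_lt_add_iff_left, hδ, mul_div_assoc', div_lt_iff₀ (by positivity)]
      linarith

/-- Moving along `-w` shifts `x j - x i` by `s * (w i - w j)`, so a single path attains the envelope
for all pairs simultaneously. -/
theorem tendsto_inner_singField (Ω w x : EuclideanSpace ℝ (Fin N)) (K : ℝ) :
    Tendsto (fun s : ℝ => inner ℝ w (singField Ω K (1 / 2) (x - s • w))) (𝓝[>] 0)
      (𝓝 (fieldEnvelope Ω K w x)) := by
  simp only [singField, inner_field Ω w _ K (kernel_neg _)]
  refine Tendsto.const_add _ (Tendsto.const_mul _ ?_)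
  refine tendsto_finsetSum _ fun i _ => tendsto_finsetSum _ fun j _ => ?_
  refine (tendsto_mul_kernel_half (w i - w j) (x j - x i)).congr fun s => ?_
  congr 2
  simp
  ring

/-- The path leaves every collision for small `s > 0`, except for pairs with `w i = w j`, whose
coefficient vanishes identically. -/
theorem eventually_continuousAt_inner_singField (Ω w x : EuclideanSpace ℝ (Fin N)) (K : ℝ) :
    ∀ᶠ s in 𝓝[>] (0 : ℝ),
      ContinuousAt (fun z => inner ℝ w (singField Ω K (1 / 2) z)) (x - s • w) := by
  have hev : ∀ᶠ s in 𝓝[>] (0 : ℝ), ∀ i j : Fin N,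
      ContinuousAt (fun θ => (w i - w j) * kernel (1 / 2) θ)
        ((x j - x i) + s * (w i - w j)) :=
    eventually_all.2 fun i => eventually_all.2 fun j =>
      eventually_continuousAt_mul_kernel_half _ _
  filter_upwards [hev] with s hs
  simp only [singField, inner_field Ω w _ K (kernel_neg _)]
  refine continuousAt_const.add (continuousAt_const.mul ?_)
  refine tendsto_finsetSum _ fun i _ => tendsto_finsetSum _ fun j _ => ?_
  have hz : (x - s • w) j - (x - s • w) i = (x j - x i) + s * (w i - w j) := by
    simp
    ring
  have hcont : Continuous fun z : EuclideanSpace ℝ (Fin N) => z j - z i := by fun_prop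
  exact ContinuousAt.comp (f := fun z : EuclideanSpace ℝ (Fin N) => z j - z i)
    (g := fun θ => (w i - w j) * kernel (1 / 2) θ) (by rw [hz]; exact hs i j) hcont.continuousAt

/-- A vector dominated by the envelope in every direction belongs to the Filippov set. -/
theorem mem_filippov_of_inner_le (Ω x v : EuclideanSpace ℝ (Fin N)) (K : ℝ)
    (h : ∀ w, inner ℝ w v ≤ fieldEnvelope Ω K w x) :
    v ∈ filippov (singField Ω K (1 / 2)) x := by
  simp only [filippov, mem_iInter]
  intro δ hδ 𝒩 h𝒩
  by_contra hv
  obtain ⟨f, u, hfu, huv⟩ :=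
    geometric_hahn_banach_closed_point (convex_convexHull ℝ _).closure isClosed_closure hv
  set w := (InnerProductSpace.toDual ℝ (EuclideanSpace ℝ (Fin N))).symm f with hw
  have hfw (z) : f z = inner ℝ w z := by rw [hw, InnerProductSpace.toDual_symm_apply]
  have hlim : Tendsto (fun s : ℝ => x - s • w) (𝓝[>] 0) (𝓝 x) := by
    have : Tendsto (fun s : ℝ => x - s • w) (𝓝 0) (𝓝 (x - (0 : ℝ) • w)) :=
      (by fun_prop : Continuous fun s : ℝ => x - s • w).tendsto 0
    rw [zero_smul, sub_zero] at this
    exact this.mono_left nhdsWithin_le_nhds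
  have hu : u < fieldEnvelope Ω K w x := by
    rw [hfw] at huv
    exact huv.trans_le (h w)
  obtain ⟨s, ⟨hs1, hs2⟩, hs3⟩ := (((tendsto_inner_singField Ω w x K).eventually_const_lt hu).and
    (eventually_continuousAt_inner_singField Ω w x K)).and
    (hlim.eventually (Metric.ball_mem_nhds x hδ)) |>.exists
  have hnhds : ∀ᶠ z in 𝓝 (x - s • w), u < inner ℝ w (singField Ω K (1 / 2) z) ∧
      z ∈ Metric.ball x δ :=
    (hs2.eventually_const_lt hs1).and (Metric.isOpen_ball.mem_nhds hs3)
  have hpos := Measure.measure_pos_of_mem_nhds (μ := (volume : Measure (EuclideanSpace ℝ (Fin N)))) hnhds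
  obtain ⟨z, ⟨hz1, hz2⟩, hz3⟩ : ({z | u < inner ℝ w (singField Ω K (1 / 2) z) ∧
      z ∈ Metric.ball x δ} \ 𝒩).Nonempty := by
    -- A neighbourhood has positive measure, so a point survives outside `𝒩`; its field value
    -- violates the strict separation.
    refine nonempty_of_measure_ne_zero (μ := volume) ?_
    rw [measure_sdiff_null h𝒩]
    exact hpos.ne'
  have := hfu _ (subset_closure (subset_convexHull ℝ _ ⟨z, ⟨hz2, hz3⟩, rfl⟩))
  rw [hfw] at this
  exact lt_asymm this hz1

/-! ### Uniform bounds on the field -/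

theorem abs_field_apply_le {K : ℝ} (hK : 0 ≤ K) (Ω x : EuclideanSpace ℝ (Fin N)) {k : ℝ → ℝ}
    (hk : ∀ θ, |k θ| ≤ 1) (i : Fin N) :
    |field Ω K k x i| ≤ Real.sqrt (∑ j, Ω j ^ 2) + K := by
  have hN : (0 : ℝ) < N := by exact_mod_cast i.pos
  refine (abs_add_le _ _).trans (add_le_add ?_ ?_)
  · refine Real.abs_le_sqrt ?_
    exact Finset.single_le_sum (f := fun j => Ω j ^ 2) (fun j _ => sq_nonneg _)
      (Finset.mem_univ i)
  · have hsum : |∑ j, k (x j - x i)| ≤ N := by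
      refine (Finset.abs_sum_le_sum_abs _ _).trans ?_
      refine (Finset.sum_le_sum fun j _ => hk (x j - x i)).trans ?_
      simp
    rw [abs_mul, abs_of_nonneg (by positivity : 0 ≤ K / (N : ℝ))]
    calc K / N * |∑ j, k (x j - x i)| ≤ K / N * N :=
          mul_le_mul_of_nonneg_left hsum (by positivity)
      _ = K := by field_simp

theorem norm_field_le {K : ℝ} (hK : 0 ≤ K) (Ω x : EuclideanSpace ℝ (Fin N)) {k : ℝ → ℝ}
    (hk : ∀ θ, |k θ| ≤ 1) :
    ‖field Ω K k x‖ ≤ Real.sqrt N * (Real.sqrt (∑ j, Ω j ^ 2) + K) := by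
  have hC : 0 ≤ Real.sqrt (∑ j, Ω j ^ 2) + K := by positivity
  rw [EuclideanSpace.norm_eq]
  refine Real.sqrt_le_iff.2 ⟨by positivity, ?_⟩
  rw [mul_pow, Real.sq_sqrt (by positivity)]
  refine (Finset.sum_le_sum fun i _ => pow_le_pow_left₀ (norm_nonneg _)
    (abs_field_apply_le hK Ω x hk i) 2).trans ?_
  simp

theorem continuous_field (Ω : EuclideanSpace ℝ (Fin N)) (K : ℝ) {k : ℝ → ℝ} (hk : Continuous k) :
    Continuous (field Ω K k) := by
  unfold field
  refine (PiLp.continuous_toLp 2 _).comp (continuous_pi fun i => ?_)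
  refine continuous_const.add (continuous_const.mul (continuous_finsetSum _ fun j _ => ?_))
  exact hk.comp (by fun_prop)

theorem ae_restrict_Ici_of_forall_Ioo {p : ℝ → Prop}
    (h : ∀ T, 0 < T → ∀ᵐ t ∂(volume.restrict (Ioo (0 : ℝ) T)), p t) :
    ∀ᵐ t ∂(volume.restrict (Ici (0 : ℝ))), p t := by
  have hU : Ioi (0 : ℝ) ⊆ ⋃ n : ℕ, Ioo (0 : ℝ) (n + 1) := fun t ht => by
    obtain ⟨n, hn⟩ := exists_nat_gt t
    exact mem_iUnion.2 ⟨n, ht, hn.trans (lt_add_one _)⟩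
  rw [← restrict_Ioi_eq_restrict_Ici]
  refine ae_restrict_of_ae_restrict_of_subset hU ?_
  rw [ae_restrict_iUnion_iff]
  exact fun n => h _ n.cast_add_one_pos

theorem tendsto_of_forall_inner {ι : Type*} {l : Filter ι} {u : ι → EuclideanSpace ℝ (Fin N)}
    {a : EuclideanSpace ℝ (Fin N)}
    (h : ∀ w, Tendsto (fun n => inner ℝ w (u n)) l (𝓝 (inner ℝ w a))) : Tendsto u l (𝓝 a) := by
  have h1 : Tendsto (fun n => WithLp.ofLp (u n)) l (𝓝 (WithLp.ofLp a)) := by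
    refine tendsto_pi_nhds.2 fun i => ?_
    simpa [EuclideanSpace.inner_single_left] using h (EuclideanSpace.single i 1)
  exact ((PiLp.continuous_toLp 2 fun _ : Fin N => ℝ).tendsto _).comp h1

/-! ### Passing to weak-* limits -/

namespace TendstoWeakStarLinf

variable {u : ℕ → ℝ → EuclideanSpace ℝ (Fin N)} {u' : ℝ → EuclideanSpace ℝ (Fin N)}

theorem tendsto_setIntegral_inner (h : TendstoWeakStarLinf u u') {T : ℝ} (hT : 0 < T)
    (w : EuclideanSpace ℝ (Fin N)) {s : Set ℝ} (hs : MeasurableSet s) :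
    Tendsto (fun n => ∫ t in s, inner ℝ w (u n t) ∂(volume.restrict (Ioo 0 T))) atTop
      (𝓝 (∫ t in s, inner ℝ w (u' t) ∂(volume.restrict (Ioo 0 T)))) := by
  have key (f : ℝ → EuclideanSpace ℝ (Fin N)) :
      ∫ t in Ioo 0 T, inner ℝ (s.indicator (fun _ => w) t) (f t) =
        ∫ t in s, inner ℝ w (f t) ∂(volume.restrict (Ioo 0 T)) := by
    rw [← integral_indicator hs]
    refine integral_congr_ae (Eventually.of_forall fun t => ?_)
    by_cases ht : t ∈ s <;> simp [ht]
  simp only [← key]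
  exact h T hT _ ((integrable_const w).indicator hs)

/-- Bounded curves converging both pointwise and weakly-* have the same limits. -/
theorem ae_eq_of_tendsto (h : TendstoWeakStarLinf u u') {x : ℝ → EuclideanSpace ℝ (Fin N)}
    {T : ℝ} (hT : 0 < T) (hu' : MemLp u' ∞ (volume.restrict (Ioo 0 T)))
    (hmeas : ∀ n, AEStronglyMeasurable (u n) (volume.restrict (Ioo 0 T))) {C : ℝ}
    (hC : ∀ n, ∀ t ∈ Ioo 0 T, ‖u n t‖ ≤ C)
    (hx : ∀ t ∈ Ioo 0 T, Tendsto (fun n => u n t) atTop (𝓝 (x t))) :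
    x =ᵐ[volume.restrict (Ioo 0 T)] u' := by
  have hmem : ∀ᵐ t ∂(volume.restrict (Ioo 0 T)), t ∈ Ioo 0 T := ae_restrict_mem measurableSet_Ioo
  have hxae : ∀ᵐ t ∂(volume.restrict (Ioo 0 T)), Tendsto (fun n => u n t) atTop (𝓝 (x t)) :=
    hmem.mono hx
  have hxmeas : AEStronglyMeasurable x (volume.restrict (Ioo 0 T)) :=
    aestronglyMeasurable_of_tendsto_ae atTop hmeas hxae
  have hxint : Integrable x (volume.restrict (Ioo 0 T)) := by
    refine Integrable.of_bound hxmeas C (hmem.mono fun t ht => ?_)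
    exact le_of_tendsto (hx t ht).norm (Eventually.of_forall fun n => hC n t ht)
  have hu'int := hu'.integrable (q := ∞) le_top
  refine Integrable.ae_eq_of_forall_setIntegral_eq _ _ hxint hu'int fun s hs _ => ?_
  refine ext_inner_left ℝ fun w => ?_
  rw [← integral_inner hxint.integrableOn, ← integral_inner hu'int.integrableOn]
  refine tendsto_nhds_unique ?_ (h.tendsto_setIntegral_inner hT w hs)
  refine tendsto_integral_of_dominated_convergence (fun _ => ‖w‖ * C) (fun n => ?_)
    (integrable_const _) (fun n => ?_) ?_
  · exact ((hmeas n).const_inner).restrict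
  · refine ae_restrict_of_ae (hmem.mono fun t ht => ?_)
    exact (norm_inner_le_norm _ _).trans (mul_le_mul_of_nonneg_left (hC n t ht) (norm_nonneg w))
  · exact ae_restrict_of_ae (hxae.mono fun t ht => tendsto_const_nhds.inner ht)

/-- Asymptotic pointwise upper bounds in a direction pass to the weak-* limit. -/
theorem ae_inner_le (h : TendstoWeakStarLinf u u') {T : ℝ} (hT : 0 < T)
    (hu' : MemLp u' ∞ (volume.restrict (Ioo 0 T)))
    (hmeas : ∀ n, AEStronglyMeasurable (u n) (volume.restrict (Ioo 0 T))) {C : ℝ}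
    (hC : ∀ n, ∀ t ∈ Ioo 0 T, ‖u n t‖ ≤ C) (w : EuclideanSpace ℝ (Fin N)) {g : ℝ → ℝ}
    (hg : AEStronglyMeasurable g (volume.restrict (Ioo 0 T))) {D : ℝ} (hD : ∀ t, |g t| ≤ D)
    (hlim : ∀ t ∈ Ioo 0 T, ∀ η, 0 < η → ∀ᶠ n in atTop, inner ℝ w (u n t) < g t + η) :
    ∀ᵐ t ∂(volume.restrict (Ioo 0 T)), inner ℝ w (u' t) ≤ g t := by
  have hmem : ∀ᵐ t ∂(volume.restrict (Ioo 0 T)), t ∈ Ioo 0 T := ae_restrict_mem measurableSet_Ioo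
  have hgint : Integrable g (volume.restrict (Ioo 0 T)) :=
    Integrable.of_bound hg D (Eventually.of_forall hD)
  have hu'int := hu'.integrable (q := ∞) le_top
  refine ae_le_of_forall_setIntegral_le (hu'int.const_inner w) hgint fun s hs _ => ?_
  have hbound (n : ℕ) (t : ℝ) (ht : t ∈ Ioo 0 T) : |inner ℝ w (u n t)| ≤ ‖w‖ * C :=
    (abs_real_inner_le_norm w (u n t)).trans
      (mul_le_mul_of_nonneg_left (hC n t ht) (norm_nonneg w))
  -- The maximum turns a one-sided asymptotic bound into pointwise convergence to `g`, so dominated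
  -- convergence applies even though `inner ℝ w (u n t)` need not converge.
  have hmax : Tendsto (fun n => ∫ t in s, max (inner ℝ w (u n t)) (g t)
      ∂(volume.restrict (Ioo 0 T))) atTop (𝓝 (∫ t in s, g t ∂(volume.restrict (Ioo 0 T)))) := by
    refine tendsto_integral_of_dominated_convergence (fun _ => max (‖w‖ * C) D) (fun n => ?_)
      (integrable_const _) (fun n => ?_) ?_
    · exact ((hmeas n).const_inner.sup hg).restrict
    · refine ae_restrict_of_ae (hmem.mono fun t ht => ?_)
      exact (abs_max_le_max_abs_abs).trans (max_le_max (hbound n t ht) (hD t))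
    · refine ae_restrict_of_ae (hmem.mono fun t ht => ?_)
      refine tendsto_order.2 ⟨fun a ha => Eventually.of_forall fun n => lt_max_of_lt_right ha,
        fun a ha => ?_⟩
      filter_upwards [hlim t ht (a - g t) (sub_pos.2 ha)] with n hn
      exact max_lt (by linarith) ha
  refine le_of_tendsto_of_tendsto' (h.tendsto_setIntegral_inner hT w hs) hmax fun n => ?_
  have hint : Integrable (fun t => inner ℝ w (u n t)) (volume.restrict (Ioo 0 T)) :=
    Integrable.of_bound (hmeas n).const_inner (‖w‖ * C) (hmem.mono fun t ht => hbound n t ht)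
  exact integral_mono hint.integrableOn (hint.sup hgint).integrableOn fun t => le_max_left _ _

/-- Weak-* convergence implies convergence of the primitives. -/
theorem tendsto_intervalIntegral (h : TendstoWeakStarLinf u u') {T : ℝ} (hT : 0 ≤ T)
    (hu' : ∀ T, 0 < T → MemLp u' ∞ (volume.restrict (Ioo 0 T)))
    (hint : ∀ n, IntegrableOn (u n) (Ioo 0 T)) :
    Tendsto (fun n => ∫ t in (0 : ℝ)..T, u n t) atTop (𝓝 (∫ t in (0 : ℝ)..T, u' t)) := by
  rcases hT.eq_or_lt with rfl | hT'
  · simp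
  refine tendsto_of_forall_inner fun w => ?_
  simp only [intervalIntegral.integral_of_le hT, integral_Ioc_eq_integral_Ioo]
  have hu'int := (hu' T hT').integrable (q := ∞) le_top
  rw [← integral_inner hu'int]
  refine (h T hT' _ (integrable_const w)).congr fun n => ?_
  exact integral_inner (hint n) w

end TendstoWeakStarLinf

/-! ### Classical solutions and limit curves -/

namespace IsClassicalSolution

variable {F : EuclideanSpace ℝ (Fin N) → EuclideanSpace ℝ (Fin N)}
  {x₀ : EuclideanSpace ℝ (Fin N)} {x : ℝ → EuclideanSpace ℝ (Fin N)}

theorem derivWithin_eq (h : IsClassicalSolution F x₀ x) {t : ℝ} (ht : 0 ≤ t) :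
    derivWithin x (Ici 0) t = F (x t) :=
  (h.hasDeriv t ht).derivWithin (uniqueDiffOn_Ici 0 t ht)

theorem continuousOn (h : IsClassicalSolution F x₀ x) : ContinuousOn x (Ici 0) :=
  fun t ht => (h.hasDeriv t ht).continuousWithinAt

theorem continuousOn_derivWithin (h : IsClassicalSolution F x₀ x) (hF : Continuous F) :
    ContinuousOn (derivWithin x (Ici 0)) (Ici 0) :=
  (hF.comp_continuousOn h.continuousOn).congr fun _ ht => h.derivWithin_eq ht

theorem eq_add_integral (h : IsClassicalSolution F x₀ x) (hF : Continuous F) {T : ℝ}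
    (hT : 0 ≤ T) : x T = x₀ + ∫ t in (0 : ℝ)..T, derivWithin x (Ici 0) t := by
  have hsub : Icc 0 T ⊆ Ici (0 : ℝ) := Icc_subset_Ici_self
  rw [intervalIntegral.integral_eq_sub_of_hasDerivAt_of_le hT (h.continuousOn.mono hsub), h.initial]
  · abel
  · intro t ht
    rw [h.derivWithin_eq ht.1.le]
    exact (h.hasDeriv t ht.1.le).hasDerivAt (Ici_mem_nhds ht.1)
  · refine ContinuousOn.intervalIntegrable ?_
    rw [uIcc_of_le hT]
    exact (h.continuousOn_derivWithin hF).mono hsub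

theorem norm_sub_le (h : IsClassicalSolution F x₀ x) {C : ℝ} (hC : ∀ y, ‖F y‖ ≤ C) {s t : ℝ}
    (hs : 0 ≤ s) (ht : 0 ≤ t) : ‖x t - x s‖ ≤ C * |t - s| :=
  (convex_Ici 0).norm_image_sub_le_of_norm_hasDerivWithin_le h.hasDeriv (fun _ _ => hC _) hs ht

theorem norm_le (h : IsClassicalSolution F x₀ x) {C : ℝ} (hC : ∀ y, ‖F y‖ ≤ C) {t T : ℝ}
    (ht : t ∈ Icc 0 T) : ‖x t‖ ≤ ‖x₀‖ + C * T := by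
  have h1 := h.norm_sub_le hC le_rfl ht.1
  rw [h.initial, sub_zero, abs_of_nonneg ht.1] at h1
  have h2 : C * t ≤ C * T := mul_le_mul_of_nonneg_left ht.2 ((norm_nonneg _).trans (hC 0))
  have h3 := norm_le_norm_add_norm_sub' (x t) x₀
  linarith

end IsClassicalSolution

/-- A pointwise limit on `[0, ∞)` of curves with a common Lipschitz constant is absolutely
continuous. -/
theorem absolutelyContinuousOnInterval_of_tendsto {u : ℕ → ℝ → EuclideanSpace ℝ (Fin N)}
    {x : ℝ → EuclideanSpace ℝ (Fin N)} {C : ℝ} (hC0 : 0 ≤ C)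
    (hC : ∀ n s t, 0 ≤ s → 0 ≤ t → ‖u n t - u n s‖ ≤ C * |t - s|)
    (hx : ∀ t, 0 ≤ t → Tendsto (fun n => u n t) atTop (𝓝 (x t))) {T : ℝ} (hT : 0 ≤ T) :
    AbsolutelyContinuousOnInterval x 0 T := by
  refine LipschitzOnWith.absolutelyContinuousOnInterval (K := ⟨C, hC0⟩) ?_
  refine LipschitzOnWith.of_dist_le_mul fun t ht s hs => ?_
  rw [uIcc_of_le hT] at ht hs
  rw [dist_eq_norm, Real.dist_eq]
  exact le_of_tendsto ((hx t ht.1).sub (hx s hs.1)).norm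
    (Eventually.of_forall fun n => hC n s t hs.1 ht.1)

theorem ae_hasDerivAt_integral_of_memLp {v : ℝ → EuclideanSpace ℝ (Fin N)}
    (hv : ∀ T, 0 < T → MemLp v ∞ (volume.restrict (Ioo 0 T))) (x₀ : EuclideanSpace ℝ (Fin N)) :
    ∀ᵐ t ∂(volume.restrict (Ici (0 : ℝ))),
      HasDerivAt (fun t => x₀ + ∫ s in (0 : ℝ)..t, v s) (v t) t := by
  refine ae_restrict_Ici_of_forall_Ioo fun T hT => ?_
  have hint : IntervalIntegrable v volume 0 T := by
    rw [intervalIntegrable_iff_integrableOn_Ioo_of_le hT.le]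
    exact (hv T hT).integrable (q := ∞) le_top
  refine (ae_restrict_iff' measurableSet_Ioo).2 ?_
  filter_upwards [hint.ae_hasDerivAt_integral] with t ht htT
  have hsub : t ∈ uIcc 0 T := by
    rw [uIcc_of_le hT.le]
    exact ⟨htT.1.le, htT.2.le⟩
  exact (ht hsub 0 left_mem_uIcc).const_add x₀

end SingularKuramoto

open SingularKuramoto
theorem mainTheorem8 (N : ℕ) (Ω Θ₀ : EuclideanSpace ℝ (Fin N)) (K : ℝ) (hK : 0 ≤ K)
    (Θ : ℝ → ℝ → EuclideanSpace ℝ (Fin N))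
    (hΘ : ∀ ε, 0 < ε → IsClassicalSolution (regField Ω K (1 / 2) ε) Θ₀ (Θ ε)) :
    (∀ ε, 0 < ε → ∀ t, 0 ≤ t → ∀ i,
      |derivWithin (Θ ε) (Ici 0) t i| ≤ Real.sqrt (∑ j, Ω j ^ 2) + K) ∧
    (∀ T, 0 < T → ∃ C, ∀ ε, 0 < ε → ∀ t ∈ Icc 0 T,
      ‖Θ ε t‖ ≤ C ∧ ‖derivWithin (Θ ε) (Ici 0) t‖ ≤ C) ∧
    (∀ (e : ℕ → ℝ) (θ v : ℝ → EuclideanSpace ℝ (Fin N)),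
      (∀ n, 0 < e n) → Tendsto e atTop (𝓝 0) →
      TendstoWeakStarW1InfLoc (fun n => Θ (e n)) (fun n => derivWithin (Θ (e n)) (Ici 0)) θ v →
      (∀ᵐ t ∂(volume.restrict (Ici (0 : ℝ))), v t ∈ filippov (singField Ω K (1 / 2)) (θ t)) ∧
      ∃ x : ℝ → EuclideanSpace ℝ (Fin N), x =ᵐ[volume.restrict (Ici (0 : ℝ))] θ ∧
        IsFilippovSolution (singField Ω K (1 / 2)) Θ₀ x) := by
  set C : ℝ := Real.sqrt N * (Real.sqrt (∑ j, Ω j ^ 2) + K) with hCdef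
  have hC0 : 0 ≤ C := by positivity
  have hF (ε : ℝ) (y : EuclideanSpace ℝ (Fin N)) : ‖regField Ω K (1 / 2) ε y‖ ≤ C :=
    norm_field_le hK Ω y (abs_regKernel_half_le_one ε)
  have hFc {ε : ℝ} (hε : 0 < ε) : Continuous (regField Ω K (1 / 2) ε) :=
    continuous_field Ω K (continuous_regKernel_half hε)
  refine ⟨fun ε hε t ht i => ?_, fun T hT => ⟨max (‖Θ₀‖ + C * T) C, fun ε hε t ht => ⟨?_, ?_⟩⟩, ?_⟩
  · rw [(hΘ ε hε).derivWithin_eq ht]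
    exact abs_field_apply_le hK Ω _ (abs_regKernel_half_le_one ε) i
  · exact ((hΘ ε hε).norm_le (hF ε) ht).trans (le_max_left _ _)
  · rw [(hΘ ε hε).derivWithin_eq ht.1]
    exact (hF ε _).trans (le_max_right _ _)
  intro e θ v he he0 hweak
  have hsol (n : ℕ) := hΘ (e n) (he n)
  have hvmem := hweak.memLimit.memLp_deriv
  have hdC (n : ℕ) (T t : ℝ) (ht : t ∈ Ioo 0 T) : ‖derivWithin (Θ (e n)) (Ici 0) t‖ ≤ C := by
    rw [(hsol n).derivWithin_eq ht.1.le]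
    exact hF _ _
  have hdmeas (n : ℕ) (T : ℝ) :
      AEStronglyMeasurable (derivWithin (Θ (e n)) (Ici 0)) (volume.restrict (Ioo 0 T)) :=
    (((hsol n).continuousOn_derivWithin (hFc (he n))).mono
      fun t ht => ht.1.le).aestronglyMeasurable measurableSet_Ioo
  have hmeas (n : ℕ) (T : ℝ) : AEStronglyMeasurable (Θ (e n)) (volume.restrict (Ioo 0 T)) :=
    ((hsol n).continuousOn.mono fun t ht => ht.1.le).aestronglyMeasurable measurableSet_Ioo
  -- The continuous representative of `θ`: the integral form of the regularized equations forces the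
  -- trajectories to converge to it at every `t ≥ 0`.
  set x : ℝ → EuclideanSpace ℝ (Fin N) := fun t => Θ₀ + ∫ s in (0 : ℝ)..t, v s with hx
  have hlim (t : ℝ) (ht : 0 ≤ t) : Tendsto (fun n => Θ (e n) t) atTop (𝓝 (x t)) := by
    simp only [fun n => (hsol n).eq_add_integral (hFc (he n)) ht]
    refine (hweak.tendsto_deriv.tendsto_intervalIntegral ht hvmem fun n => ?_).const_add Θ₀
    exact Integrable.of_bound (hdmeas n t) C
      ((ae_restrict_mem measurableSet_Ioo).mono (hdC n t))
  have hxθ : x =ᵐ[volume.restrict (Ici (0 : ℝ))] θ :=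
    ae_restrict_Ici_of_forall_Ioo fun T hT =>
      hweak.tendsto.ae_eq_of_tendsto hT (hweak.memLimit.memLp T hT) (fun n => hmeas n T)
        (fun n t ht => (hsol n).norm_le (hF _) (Ioo_subset_Icc_self ht))
        fun t ht => hlim t ht.1.le
  have henv (w : EuclideanSpace ℝ (Fin N)) :
      ∀ᵐ t ∂(volume.restrict (Ici (0 : ℝ))), inner ℝ w (v t) ≤ fieldEnvelope Ω K w (x t) := by
    refine ae_restrict_Ici_of_forall_Ioo fun T hT => ?_
    obtain ⟨D, hD⟩ := exists_abs_fieldEnvelope_le Ω K w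
    have hxmeas : AEMeasurable x (volume.restrict (Ioo 0 T)) :=
      aemeasurable_of_tendsto_metrizable_ae' (fun n => (hmeas n T).aemeasurable)
        ((ae_restrict_mem measurableSet_Ioo).mono fun t ht => hlim t ht.1.le)
    refine hweak.tendsto_deriv.ae_inner_le hT (hvmem T hT) (fun n => hdmeas n T)
      (fun n t => hdC n T t) w
      ((measurable_fieldEnvelope Ω K w).comp_aemeasurable hxmeas).aestronglyMeasurable
      (fun t => hD (x t)) fun t ht η hη => ?_
    filter_upwards [eventually_inner_regField_lt hK Ω w he0 (hlim t ht.1.le) hη] with n hn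
    rwa [(hsol n).derivWithin_eq ht.1.le]
  have hincl : ∀ᵐ t ∂(volume.restrict (Ici (0 : ℝ))),
      v t ∈ filippov (singField Ω K (1 / 2)) (x t) := by
    -- The exceptional null set in `henv` depends on `w`; countably many directions share one, and
    -- continuity of the envelope in `w` gives the rest.
    filter_upwards [ae_all_iff.2 fun k : ℕ =>
      henv (TopologicalSpace.denseSeq (EuclideanSpace ℝ (Fin N)) k)] with t ht
    refine mem_filippov_of_inner_le Ω (x t) (v t) K fun w => ?_
    have hclosed : IsClosed {w | inner ℝ w (v t) ≤ fieldEnvelope Ω K w (x t)} :=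
      isClosed_le (continuous_id.inner continuous_const) (continuous_fieldEnvelope_left Ω K (x t))
    exact (TopologicalSpace.denseRange_denseSeq (EuclideanSpace ℝ (Fin N))).induction_on w hclosed ht
  refine ⟨?_, x, hxθ, ?_, fun T hT => ?_, ?_⟩
  · filter_upwards [hincl, hxθ] with t ht hxt
    rwa [← hxt]
  · simp [hx]
  · exact absolutelyContinuousOnInterval_of_tendsto hC0
      (fun n s t hs ht => (hsol n).norm_sub_le (hF _) hs ht) hlim hT.le
  · filter_upwards [hincl, ae_hasDerivAt_integral_of_memLp hvmem Θ₀] with t ht hder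
    exact ⟨v t, ht, hder⟩
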